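/- \textbf{Lemma (Honest Good Proposer).} Consider one block-commit round with a finite committee $V$ of $n\le 2300$ citizens and a finite set of politicians, of which at most a fraction $\gamma=0.8$ is malicious. A committee member $v$ is \emph{good} if it is honest and its sample $S(v)$ of politicians contains an honest one, and \emph{bad} otherwise; the number $n_b$ of bad members satisfies $n\ge 3n_b+1$. Bad members and malicious politicians behave arbitrarily, collude and know all random choices, but cannot forge signatures of good members. The parameters are $\rho=45$, $\tilde n_b=772$, $\Delta=350$. The round proceeds as follows. (1) Distinct politicians $T_1,\dots,T_\rho$ each provide a tx\_pool, with a commitment (its signed hash). A malicious $T_i$ may sign several commitments and serve only some citizens; an honest $T_i$ signs one and serves all honest citizens. The witness list of $v$ lists the commitments whose tx\_pools $v$ has downloaded. Witness lists are broadcast: a good citizen uploads its signed message to all of $S(v)$, every honest politician sends all it has to all politicians, and each citizen downloads from its sample. (2) A proposer proposes the commitments that it sees in the witness lists of at least $\tilde n_b+\Delta$ members; it drops the commitments of a $T_i$ for which it sees two different signed commitments. Proposals are broadcast. (3) Every member $v$, independently, chooses uniformly $5$ distinct tx\_pools that it has (all of them if it has fewer than $5$) and one uniformly random politician, and uploads these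 tx\_pools to it. The politicians gossip the tx\_pools, in an arbitrary order in which every honest politician gets around to every other honest politician with every tx\_pool that it had at the start of the gossip. Each citizen then downloads from its sample the tx\_pools that it lacks. (4) Each member enters the consensus with the least-VRF proposal that it has received, if it has all tx\_pools committed in it, and with NULL otherwise. The consensus is Byzantine agreement by two-step graded consensus followed by the binary agreement BBA, with thresholds $2n/3$ and $n/3$; votes are broadcast as in (1). The \emph{winning proposer} is the proposer whose VRF value is strictly the least among all proposers of the committee. If the winning proposer is a good citizen, then, whatever happened up to the moment of the random choices in (3) and whatever the adversary does, with probability at least $1-0.017$ over these choices all good citizens enter the consensus with the proposal of the winner, and halt and output this proposal. -/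

import Mathlib

open MeasureTheory ProbabilityTheory

noncomputable section

namespace Blockene

/-- `ρ`: the number of politicians that provide a tx_pool for the block. -/
def rho : ℕ := 45

/-- The upper bound on the number of bad citizens in a committee that is built into the
protocol. -/
def maxBad : ℕ := 772

/-- `Δ`. -/
def delta : ℕ := 350

/-- The number of tx_pools that a citizen re-uploads before the consensus. -/
def reuploadSize : ℕ := 5

/-- A list with one entry per providing politician: a commitment (the signed hash of a tx_pool)
or `none`. Witness lists and the lists in block proposals have this form. -/
abbrev CommitmentList (Digest : Type*) := Fin rho → Option Digest

/-- A block proposal: its author and the commitments in it. The VRF of the author is determined by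
the author. -/
abbrev Proposal (V Digest : Type*) := V × CommitmentList Digest

/-- A block-commit round, up to the moment at which the citizens have downloaded their tx_pools:
`V` is the committee, `P` the set of politicians, `Pool` the set of possible tx_pools, and `Digest`
the set of hash values. Everything in it may have been influenced by the adversary, within the laws
at the end. -/
structure Round (V P Pool Digest : Type*) where
  /-- the honest committee members -/
  honestCitizen : Set V
  /-- the honest politicians -/
  honestPolitician : Set P
  /-- the random subset of politicians that a citizen talks to during the whole protocol -/
  sample : V → Finset P
  /-- the politicians `T₁, …, T_ρ` that provide the tx_pools of this block -/
  provider : Fin rho → P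
  hash : Pool → Digest
  /-- the hash values that `Tᵢ` has signed for this round -/
  signed : Fin rho → Set Digest
  /-- the tx_pool frozen by `Tᵢ`; used for honest `Tᵢ` only -/
  ownPool : Fin rho → Pool
  /-- the tx_pool, if any, that a citizen has downloaded from `Tᵢ` with a valid commitment -/
  pool : V → Fin rho → Option Pool
  /-- the committee members that may propose a block -/
  proposers : Set V
  /-- the (publicly verifiable) VRF value that ranks the proposers -/
  vrf : V → ℕ
  /-- the hash of a member's (unique) signature that serves to flip the `k`-th common coin in the
  binary consensus -/
  coinHash : V → ℕ → ℕ
  provider_injective : Function.Injective provider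
  /-- an honest politician signs one commitment, -/
  signed_of_honest : ∀ i, provider i ∈ honestPolitician → signed i = {hash (ownPool i)}
  /-- and gives its tx_pool to everyone who asks -/
  pool_of_honest : ∀ v i, v ∈ honestCitizen → provider i ∈ honestPolitician →
    pool v i = some (ownPool i)
  /-- an honest citizen accepts a tx_pool only with a signed commitment to it -/
  hash_mem_signed : ∀ v i m, v ∈ honestCitizen → pool v i = some m → hash m ∈ signed i

/-- What the adversary does in one broadcast of signed messages (of type `M`) through the
politicians. -/
structure BroadcastAdversary (V P M : Type*) where
  /-- messages (with their authors) that the adversary uploads to a politician -/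
  upload : P → Set (V × M)
  /-- messages that the adversary sends to a politician during the broadcast or after it -/
  relay : P → Set (V × M)
  /-- messages that a malicious politician returns to a citizen that downloads from it -/
  reply : V → P → Set (V × M)

/-- What the adversary does from the time of the witness lists on. -/
structure Adversary (V P Pool Digest : Type*) where
  /-- broadcast of the witness lists -/
  witness : BroadcastAdversary V P (CommitmentList Digest)
  /-- broadcast of the block proposals -/
  proposal : BroadcastAdversary V P (CommitmentList Digest)
  /-- tx_pools that the adversary uploads to a politician -/
  extraPools : P → Finset Pool
  /-- the sequence of transmissions (from, to, what) in the gossip of the tx_pools -/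
  schedule : List (P × P × Pool)
  /-- tx_pools that a malicious politician returns to a citizen that downloads from it -/
  poolReply : V → P → Set Pool
  /-- first voting step of the consensus protocol -/
  vote₁ : BroadcastAdversary V P (Option (Proposal V Digest))
  /-- second voting step of the consensus protocol -/
  vote₂ : BroadcastAdversary V P (Option (Proposal V Digest))
  /-- the steps of the binary consensus protocol -/
  bba : ℕ → BroadcastAdversary V P Bool

namespace Round

variable {V P Pool Digest : Type*}

/-- A committee member is good if it is honest and talks to at least one honest politician. -/
def Good (R : Round V P Pool Digest) (v : V) : Prop :=
  v ∈ R.honestCitizen ∧ ∃ p ∈ R.sample v, p ∈ R.honestPolitician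

/-- The number `n_b` of bad committee members. -/
def numBad (R : Round V P Pool Digest) : ℕ := {v : V | ¬ R.Good v}.ncard

/-- The winning proposer is the one with the least VRF. -/
def IsWinningProposer (R : Round V P Pool Digest) (u : V) : Prop :=
  u ∈ R.proposers ∧ ∀ w ∈ R.proposers, w ≠ u → R.vrf u < R.vrf w

/-! ### Broadcast through the politicians -/

section Broadcast

variable {M : Type*} (R : Round V P Pool Digest)

/-- Signatures: the messages in `X` that survive the signature check, if the good citizen `w` has
signed exactly the message `sent w` (or nothing). -/
def authentic (sent : V → Option M) (X : Set (V × M)) : Set (V × M) :=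
  {x ∈ X | R.Good x.1 → sent x.1 = some x.2}

/-- The messages uploaded to the politician `p`: a good citizen uploads its message to all of its
sample. -/
def uploaded (a : BroadcastAdversary V P M) (sent : V → Option M) (p : P) : Set (V × M) :=
  {x | R.Good x.1 ∧ sent x.1 = some x.2 ∧ p ∈ R.sample x.1} ∪ R.authentic sent (a.upload p)

/-- The messages that the honest politician `p` holds after a full broadcast, in which every honest
politician sends all it has to all politicians. -/
def stored (a : BroadcastAdversary V P M) (sent : V → Option M) (p : P) : Set (V × M) :=
  {x | ∃ q ∈ R.honestPolitician, x ∈ R.uploaded a sent q} ∪ R.authentic sent (a.relay p)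

/-- The messages that the good citizen `v` downloads from its sample. -/
def download (a : BroadcastAdversary V P M) (sent : V → Option M) (v : V) : Set (V × M) :=
  {x | ∃ p ∈ R.sample v,
    (p ∈ R.honestPolitician ∧ x ∈ R.stored a sent p) ∨
    (p ∉ R.honestPolitician ∧ x ∈ R.authentic sent (a.reply v p))}

end Broadcast

/-! ### Witness lists and block proposals -/

section Propose

variable (R : Round V P Pool Digest)

/-- The witness list of a citizen. -/
def witnessList (v : V) : CommitmentList Digest := fun i => (R.pool v i).map R.hash

/-- The witness lists that `v` downloads. -/
def witnessView (a : Adversary V P Pool Digest) (v : V) : Set (V × CommitmentList Digest) :=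
  R.download a.witness (fun w => some (R.witnessList w)) v

/-- The proposer picks, for the provider `i`, the commitment `d` if it is in the witness lists of at
least `maxBad + delta` committee members. If two different commitments signed by the provider are in
the lists that the proposer sees, it drops all commitments of this provider. -/
def Picks (view : Set (V × CommitmentList Digest)) (i : Fin rho) (d : Digest) : Prop :=
  d ∈ R.signed i ∧
  maxBad + delta ≤ {w : V | ∃ L, (w, L) ∈ view ∧ L i = some d}.ncard ∧
  ∀ w L d', (w, L) ∈ view → L i = some d' → d' ∈ R.signed i → d' = d

open Classical in
/-- The list of the commitments that the proposer picks. -/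
def idList (view : Set (V × CommitmentList Digest)) : CommitmentList Digest := fun i =>
  if h : ∃ d, R.Picks view i d then some h.choose else none

/-- The block proposal of `u`, when `u` follows the protocol. -/
def proposalOf (a : Adversary V P Pool Digest) (u : V) : Proposal V Digest :=
  (u, R.idList (R.witnessView a u))

open Classical in
/-- The block proposals that `v` downloads and that come from a proposer. -/
def proposalView (a : Adversary V P Pool Digest) (v : V) : Set (Proposal V Digest) :=
  {x ∈ R.download a.proposal
    (fun w => if w ∈ R.proposers then some (R.proposalOf a w).2 else none) v | x.1 ∈ R.proposers}

/-- `x` is a proposal with least VRF among those that `v` downloads. -/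
def IsLocalWinner (a : Adversary V P Pool Digest) (v : V) (x : Proposal V Digest) : Prop :=
  x ∈ R.proposalView a v ∧ ∀ y ∈ R.proposalView a v, R.vrf x.1 ≤ R.vrf y.1

end Propose

/-! ### The random re-uploads -/

section Reupload

variable (R : Round V P Pool Digest)

open Classical in
/-- The indices of the tx_pools that `v` has downloaded. -/
def held (v : V) : Finset (Fin rho) := Finset.univ.filter fun i => R.pool v i ≠ none

/-- The possible choices of `v` in the re-upload: 5 (distinct) indices of tx_pools that it has (all
of them if it has fewer), and one politician, to which it uploads these tx_pools. -/
def Choice (v : V) : Type _ :=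
  {c : Finset (Fin rho) × P // c.1 ⊆ R.held v ∧ c.1.card = min reuploadSize (R.held v).card}

instance (v : V) : MeasurableSpace (R.Choice v) := ⊤

instance (v : V) [Finite P] : Finite (R.Choice v) := by
  unfold Choice; infer_instance

instance (v : V) : Nonempty (R.Choice v) := by
  obtain ⟨s, hs, hc⟩ := Finset.exists_subset_card_eq (min_le_right reuploadSize (R.held v).card)
  exact ⟨⟨(s, R.provider ⟨0, by decide⟩), hs, hc⟩⟩

/-- The choices of all committee members. -/
abbrev Choices : Type _ := ∀ v : V, R.Choice v

/-- The citizens choose uniformly and independently of each other. -/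
def choiceLaw [Fintype V] : Measure R.Choices :=
  Measure.pi fun v => uniformOn (Set.univ : Set (R.Choice v))

instance (v : V) [Finite P] : IsProbabilityMeasure (uniformOn (Set.univ : Set (R.Choice v))) :=
  isProbabilityMeasure_uniformOn Set.finite_univ Set.univ_nonempty

instance [Fintype V] [Finite P] : IsProbabilityMeasure R.choiceLaw := by
  unfold choiceLaw; infer_instance

/-- The tx_pools that politician `p` has before the gossip: those re-uploaded to it by good citizens,
its own, and those uploaded by the adversary. -/
def initialPools (a : Adversary V P Pool Digest) (ω : R.Choices) (p : P) : Set Pool :=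
  {m | ∃ v, R.Good v ∧ (ω v).1.2 = p ∧ ∃ i ∈ (ω v).1.1, R.pool v i = some m} ∪
  {m | ∃ i, R.provider i = p ∧ R.ownPool i = m} ∪ a.extraPools p

/-- One transmission `(A, B, m)` of the gossip: if `A` is honest, then it sends `m` to `B` only if it
has `m`; a malicious `A` may send anything. -/
def gossipStep (store : P → Set Pool) (e : P × P × Pool) : P → Set Pool := fun q =>
  store q ∪ {m | q = e.2.1 ∧ m = e.2.2 ∧ (e.1 ∈ R.honestPolitician → m ∈ store e.1)}

/-- The tx_pools that politicians have after the gossip. -/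
def finalPools (a : Adversary V P Pool Digest) (ω : R.Choices) : P → Set Pool :=
  a.schedule.foldl R.gossipStep (R.initialPools a ω)

/-- In the gossip, an honest politician gets around to every other honest politician with every
tx_pool that it had at the start. The order (that is, the priorities), further transmissions, and
what malicious politicians do, are arbitrary. -/
def GossipComplete (a : Adversary V P Pool Digest) (ω : R.Choices) : Prop :=
  ∀ A ∈ R.honestPolitician, ∀ B ∈ R.honestPolitician, A ≠ B →
    ∀ m ∈ R.initialPools a ω A, (A, B, m) ∈ a.schedule

/-- The tx_pools that `v` has after the download of missing tx_pools from its sample. -/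
def availablePools (a : Adversary V P Pool Digest) (ω : R.Choices) (v : V) : Set Pool :=
  {m | ∃ i, R.pool v i = some m} ∪
  {m | ∃ p ∈ R.sample v, (p ∈ R.honestPolitician ∧ m ∈ R.finalPools a ω p) ∨
    (p ∉ R.honestPolitician ∧ m ∈ a.poolReply v p)}

/-- `v` has the tx_pools for all the commitments in `L`. -/
def HasAll (a : Adversary V P Pool Digest) (ω : R.Choices) (v : V) (L : CommitmentList Digest) :
    Prop :=
  ∀ i d, L i = some d → ∃ m ∈ R.availablePools a ω v, R.hash m = d

open Classical in
/-- The value with which `v` enters the consensus protocol: the proposal of the local winner if `v`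
has all of its tx_pools, and `none` (NULL) otherwise. -/
def initialValue (a : Adversary V P Pool Digest) (ω : R.Choices) (v : V) :
    Option (Proposal V Digest) :=
  if h : ∃ x, R.IsLocalWinner a v x then
    if R.HasAll a ω v h.choose.2 then some h.choose else none
  else none

end Reupload

/-! ### The consensus protocol

Byzantine agreement on strings: a graded consensus (two voting steps), followed by the binary
Byzantine agreement BBA. The votes are broadcast through the politicians. -/

section Consensus

/-- The number of members from which exactly one message has been received, namely `m`. -/
def tally {M : Type*} (D : Set (V × M)) (m : M) : ℕ :=
  {w : V | ∀ m', (w, m') ∈ D ↔ m' = m}.ncard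

/-- `m` has the votes of more than two thirds of the committee. -/
def TwoThirds {M : Type*} [Fintype V] (D : Set (V × M)) (m : M) : Prop :=
  2 * Fintype.card V < 3 * tally D m

/-- `m` has the votes of more than one third of the committee. -/
def OneThird {M : Type*} [Fintype V] (D : Set (V × M)) (m : M) : Prop :=
  Fintype.card V < 3 * tally D m

variable [Fintype V] (R : Round V P Pool Digest)

/-- The votes received in the first step, in which members send their initial values. -/
def votes₁ (a : Adversary V P Pool Digest) (ω : R.Choices) (v : V) :
    Set (V × Option (Proposal V Digest)) :=
  R.download a.vote₁ (fun w => some (R.initialValue a ω w)) v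

open Classical in
/-- In the second step, `v` sends the value with more than two thirds of the votes, if any. -/
def secondVote (a : Adversary V P Pool Digest) (ω : R.Choices) (v : V) :
    Option (Option (Proposal V Digest)) :=
  if h : ∃ x, TwoThirds (R.votes₁ a ω v) x then some h.choose else none

/-- The votes received in the second step. -/
def votes₂ (a : Adversary V P Pool Digest) (ω : R.Choices) (v : V) :
    Set (V × Option (Proposal V Digest)) :=
  R.download a.vote₂ (R.secondVote a ω) v

open Classical in
/-- The value and the grade with which `v` leaves the graded consensus. -/
def gradedValue (a : Adversary V P Pool Digest) (ω : R.Choices) (v : V) :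
    Option (Proposal V Digest) × ℕ :=
  if h : ∃ x, x ≠ none ∧ TwoThirds (R.votes₂ a ω v) x then (h.choose, 2)
  else if h : ∃ x, x ≠ none ∧ OneThird (R.votes₂ a ω v) x then (h.choose, 1)
  else (none, 0)

/-- State of a member in the binary consensus: its current bit (`false` is 0 and `true` is 1), and
its output, once it has halted. A halted member keeps voting for its output. -/
structure BinaryState where
  bit : Bool
  out : Option Bool

/-- The common coin as seen by a member that has received the messages `D`: the last bit of the
least hash value of the senders. -/
def coin (k : ℕ) (D : Set (V × Bool)) : Bool :=
  (sInf {h : ℕ | ∃ w b, (w, b) ∈ D ∧ h = R.coinHash w k}).testBit 0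

open Classical in
/-- Step `r` of the binary consensus for a member in state `s` that has received the bits `D`. The
steps cycle through: coin fixed to 0, coin fixed to 1, coin genuinely flipped. -/
def binaryStep (r : ℕ) (D : Set (V × Bool)) (s : BinaryState) : BinaryState :=
  if s.out ≠ none then s
  else if r % 3 = 0 then
    if TwoThirds D false then ⟨false, some false⟩
    else if TwoThirds D true then ⟨true, none⟩
    else ⟨false, none⟩
  else if r % 3 = 1 then
    if TwoThirds D true then ⟨true, some true⟩
    else if TwoThirds D false then ⟨false, none⟩
    else ⟨true, none⟩
  else
    if TwoThirds D false then ⟨false, none⟩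
    else if TwoThirds D true then ⟨true, none⟩
    else ⟨R.coin (r / 3) D, none⟩

/-- The states of the members before step `r` of the binary consensus. The initial bit is 0 for grade
2 and 1 otherwise. -/
def binaryState (a : Adversary V P Pool Digest) (ω : R.Choices) : ℕ → V → BinaryState
  | 0 => fun v => ⟨decide ((R.gradedValue a ω v).2 ≠ 2), none⟩
  | r + 1 => fun v => R.binaryStep r
      (R.download (a.bba r) (fun w => some (binaryState a ω r w).bit) v) (binaryState a ω r v)

/-- The output of `v` in the consensus protocol before step `r` of the binary consensus: `none` if it
has not yet halted, `some none` if its output is NULL, and `some (some x)` if its output is the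
proposal `x`. -/
def output (a : Adversary V P Pool Digest) (ω : R.Choices) (v : V) (r : ℕ) :
    Option (Option (Proposal V Digest)) :=
  (R.binaryState a ω r v).out.map fun b => if b then none else (R.gradedValue a ω v).1

/-- All good citizens enter the consensus protocol with the proposal `x`, halt, and output `x`. -/
def AllGoodAgreeOn (a : Adversary V P Pool Digest) (ω : R.Choices) (x : Proposal V Digest) : Prop :=
  ∀ v, R.Good v → R.initialValue a ω v = some x ∧
    ∃ r₀, ∀ r ≥ r₀, R.output a ω v r = some (some x)

end Consensus

end Round

end Blockene

end

/-! Broadcast between good members is reliable: each reaches an honest politician, and signatures of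
good members cannot be forged (`mem_download_iff`). Hence all good members single out the proposal
of a good winner (`isLocalWinner_iff`), and if all enter with it, they make up more than two thirds
of the committee and force it as output (`allGoodAgreeOn_of_initialValue`). Only the availability of
its tx_pools is left to chance.

At most 766 members are bad, so a proposed commitment has at least 1122 - 766 = 356 good witnesses.
A single upload to an honest politician suffices, since gossip spreads it to every good member
(`hasAll_proposalOf`). Each good witness achieves this with probability at least (5/45)(1/5) = 1/45,
independently, so a given provider fails with probability at most (44/45)^356, and a union bound
over the 45 providers finishes (`choiceLaw_exists_missing_le`). The failure event involves only data
fixed before the random choices, so an adversary that sees them gains nothing. -/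

namespace Blockene

namespace Round

variable {V P Pool Digest : Type*}

/-! ### Broadcast -/

theorem mem_download_iff (R : Round V P Pool Digest) {M : Type*} (a : BroadcastAdversary V P M)
    (sent : V → Option M) {v w : V} (hv : R.Good v) (hw : R.Good w) (m : M) :
    (w, m) ∈ R.download a sent v ↔ sent w = some m := by
  constructor
  -- Except for uploads by good members, every route passes the signature check.
  · rintro ⟨p, -, ⟨-, ⟨q, -, h | h⟩ | h⟩ | ⟨-, h⟩⟩
    · exact h.2.1
    all_goals exact h.2 hw
  · intro h
    obtain ⟨-, p, hp, hph⟩ := hv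
    have hw' := hw
    obtain ⟨-, q, hq, hqh⟩ := hw'
    exact ⟨p, hp, Or.inl ⟨hph, Or.inl ⟨q, hqh, Or.inl ⟨hw, h, hq⟩⟩⟩⟩

/-! ### Voting -/

/-- A member is counted only if exactly one message came from it, so the supporters of distinct
messages are disjoint. This makes the values picked by `choose` in the protocol well determined. -/
theorem TwoThirds.unique [Fintype V] {M : Type*} {D : Set (V × M)} {m m' : M}
    (h : TwoThirds D m) (h' : TwoThirds D m') : m = m' := by
  by_contra hne
  have hd : Disjoint {w : V | ∀ x, (w, x) ∈ D ↔ x = m} {w : V | ∀ x, (w, x) ∈ D ↔ x = m'} := by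
    rw [Set.disjoint_left]
    intro w hw hw'
    exact hne ((hw' m).1 ((hw m).2 rfl))
  have h₁ := Set.ncard_union_eq hd (Set.toFinite _) (Set.toFinite _)
  have h₂ := Set.ncard_le_card ({w : V | ∀ x, (w, x) ∈ D ↔ x = m} ∪
    {w : V | ∀ x, (w, x) ∈ D ↔ x = m'})
  rw [Nat.card_eq_fintype_card] at h₂
  unfold TwoThirds tally at h h'
  omega

theorem ncard_good_add_numBad [Fintype V] (R : Round V P Pool Digest) :
    {v : V | R.Good v}.ncard + R.numBad = Fintype.card V := by
  rw [← Nat.card_eq_fintype_card]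
  exact Set.ncard_add_ncard_compl {v : V | R.Good v}

/-- If all good members vote for `m`, then every good member sees more than two thirds of the
committee vote for `m`. -/
theorem twoThirds_download [Fintype V] (R : Round V P Pool Digest)
    (hgap : 3 * R.numBad + 1 ≤ Fintype.card V) {M : Type*} (a : BroadcastAdversary V P M)
    (sent : V → Option M) {m : M} (hsent : ∀ w, R.Good w → sent w = some m) {v : V}
    (hv : R.Good v) : TwoThirds (R.download a sent v) m := by
  have hsub : {w : V | R.Good w} ⊆ {w : V | ∀ x, (w, x) ∈ R.download a sent v ↔ x = m} := by
    intro w hw x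
    rw [R.mem_download_iff a sent hv hw, hsent w hw, Option.some_inj, eq_comm]
  have h₁ := Set.ncard_le_ncard hsub (Set.toFinite _)
  have h₂ := R.ncard_good_add_numBad
  unfold TwoThirds tally
  omega

/-! ### Validity of the consensus protocol -/

section Consensus

variable [Fintype V] (R : Round V P Pool Digest) (a : Adversary V P Pool Digest) (ω : R.Choices)
  {x : Proposal V Digest}

theorem secondVote_eq (hgap : 3 * R.numBad + 1 ≤ Fintype.card V)
    (hx : ∀ v, R.Good v → R.initialValue a ω v = some x) {v : V} (hv : R.Good v) :
    R.secondVote a ω v = some (some x) := by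
  have h : TwoThirds (R.votes₁ a ω v) (some x) :=
    R.twoThirds_download hgap _ _ (fun w hw => by rw [hx w hw]) hv
  have hex : ∃ y, TwoThirds (R.votes₁ a ω v) y := ⟨_, h⟩
  unfold secondVote
  rw [dif_pos hex, hex.choose_spec.unique h]

theorem gradedValue_eq (hgap : 3 * R.numBad + 1 ≤ Fintype.card V)
    (hx : ∀ v, R.Good v → R.initialValue a ω v = some x) {v : V} (hv : R.Good v) :
    R.gradedValue a ω v = (some x, 2) := by
  have h : TwoThirds (R.votes₂ a ω v) (some x) :=
    R.twoThirds_download hgap _ _ (fun w hw => R.secondVote_eq a ω hgap hx hw) hv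
  have hex : ∃ y, y ≠ none ∧ TwoThirds (R.votes₂ a ω v) y := ⟨_, by simp, h⟩
  unfold gradedValue
  rw [dif_pos hex, hex.choose_spec.2.unique h]

/-- Grade 2 gives every good member the bit 0, and step 0 has its coin fixed to 0, so good members
halt at once; a halted state never changes. -/
theorem binaryState_succ_eq (hgap : 3 * R.numBad + 1 ≤ Fintype.card V)
    (hx : ∀ v, R.Good v → R.initialValue a ω v = some x) {v : V} (hv : R.Good v) (r : ℕ) :
    R.binaryState a ω (r + 1) v = ⟨false, some false⟩ := by
  induction r with
  | zero =>
    have h : TwoThirds (R.download (a.bba 0) (fun w => some (R.binaryState a ω 0 w).bit) v)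
        false :=
      R.twoThirds_download hgap _ _
        (fun w hw => by simp [binaryState, R.gradedValue_eq a ω hgap hx hw]) hv
    rw [binaryState]
    beta_reduce
    rw [binaryStep, if_neg (by simp [binaryState]), if_pos (by simp), if_pos h]
  | succ r ih =>
    rw [binaryState]
    beta_reduce
    rw [ih, binaryStep, if_pos (by simp)]

theorem allGoodAgreeOn_of_initialValue (hgap : 3 * R.numBad + 1 ≤ Fintype.card V)
    (hx : ∀ v, R.Good v → R.initialValue a ω v = some x) : R.AllGoodAgreeOn a ω x := by
  intro v hv
  refine ⟨hx v hv, 1, fun r hr => ?_⟩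
  obtain ⟨k, rfl⟩ := Nat.exists_eq_add_of_le' hr
  simp [output, R.binaryState_succ_eq a ω hgap hx hv, R.gradedValue_eq a ω hgap hx hv]

end Consensus

/-! ### Block proposals -/

section Propose

variable (R : Round V P Pool Digest) (a : Adversary V P Pool Digest)

/-- The proposal of `u` reaches `v`, no other can be forged in its name, and every other proposer
has a strictly larger VRF. -/
theorem isLocalWinner_iff {u v : V} (hu : R.Good u) (hwin : R.IsWinningProposer u)
    (hv : R.Good v) (x : Proposal V Digest) :
    R.IsLocalWinner a v x ↔ x = R.proposalOf a u := by
  have hmem : ∀ L, (u, L) ∈ R.proposalView a v ↔ L = (R.proposalOf a u).2 := by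
    intro L
    unfold proposalView
    rw [Set.mem_ofPred_eq, R.mem_download_iff _ _ hv hu]
    simp [hwin.1, eq_comm]
  have hu' : R.proposalOf a u ∈ R.proposalView a v := (hmem _).2 rfl
  constructor
  · rintro ⟨hx, hmin⟩
    have h₁ : x.1 = u := by
      by_contra hne
      exact absurd (hmin _ hu') (not_le.2 (hwin.2 x.1 hx.2 hne))
    obtain ⟨w, L⟩ := x
    obtain rfl : w = u := h₁
    rw [(hmem L).1 hx]
    rfl
  · rintro rfl
    refine ⟨hu', fun y hy => ?_⟩
    by_cases hne : y.1 = u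
    · exact le_of_eq (congrArg R.vrf hne.symm)
    · exact (hwin.2 y.1 hy.2 hne).le

theorem initialValue_eq (ω : R.Choices) {u v : V} (hu : R.Good u)
    (hwin : R.IsWinningProposer u) (hv : R.Good v)
    (hall : R.HasAll a ω v (R.proposalOf a u).2) :
    R.initialValue a ω v = some (R.proposalOf a u) := by
  have hex : ∃ x, R.IsLocalWinner a v x := ⟨_, (R.isLocalWinner_iff a hu hwin hv _).2 rfl⟩
  have hc : hex.choose = R.proposalOf a u :=
    (R.isLocalWinner_iff a hu hwin hv _).1 hex.choose_spec
  unfold initialValue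
  rw [dif_pos hex, hc, if_pos hall]

theorem picks_of_idList {view : Set (V × CommitmentList Digest)} {i : Fin rho} {d : Digest}
    (h : R.idList view i = some d) : R.Picks view i d := by
  unfold idList at h
  split at h
  · next hex => exact Option.some_inj.1 h ▸ hex.choose_spec
  · simp at h

open Classical in
/-- The good members that hold a tx_pool of the `i`-th provider. -/
noncomputable def goodHolders [Fintype V] (i : Fin rho) : Finset V :=
  Finset.univ.filter fun v => R.Good v ∧ i ∈ R.held v

theorem mem_held {v : V} {i : Fin rho} : i ∈ R.held v ↔ R.pool v i ≠ none := by
  rw [held, Finset.mem_filter, and_iff_right (Finset.mem_univ _)]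

open Classical in
theorem mem_goodHolders [Fintype V] {v : V} {i : Fin rho} :
    v ∈ R.goodHolders i ↔ R.Good v ∧ i ∈ R.held v := by
  rw [goodHolders, Finset.mem_filter, and_iff_right (Finset.mem_univ _)]

/-- The proposer sees the witness list of `v`, so a second signed commitment there would have made
it drop the provider. Thus the tx_pool of any good holder serves. -/
theorem hash_eq_of_picks {u v : V} (hu : R.Good u) (hv : R.Good v) {i : Fin rho} {d : Digest}
    (hd : R.Picks (R.witnessView a u) i d) {m : Pool} (hm : R.pool v i = some m) :
    R.hash m = d :=
  hd.2.2 v (R.witnessList v) _ ((R.mem_download_iff _ _ hu hv _).2 rfl)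
    (by simp [witnessList, hm]) (R.hash_mem_signed v i m hv.1 hm)

/-- A commitment that a good proposer picks is backed by the tx_pools of many good members. -/
theorem le_card_goodHolders [Fintype V] {u : V} (hu : R.Good u) {i : Fin rho} {d : Digest}
    (hd : R.Picks (R.witnessView a u) i d) :
    maxBad + delta ≤ (R.goodHolders i).card + R.numBad := by
  refine hd.2.1.trans (le_trans (Set.ncard_le_ncard (t := ↑(R.goodHolders i) ∪ {v | ¬ R.Good v})
    ?_ (Set.toFinite _)) ((Set.ncard_union_le _ _).trans ?_))
  · rintro w ⟨L, hL, hLi⟩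
    by_cases hw : R.Good w
    · left
      have h := (R.mem_download_iff _ _ hu hw _).1 hL
      rw [Option.some_inj] at h
      rw [← h] at hLi
      have : R.pool w i ≠ none := by
        intro h0
        simp [witnessList, h0] at hLi
      exact R.mem_goodHolders.2 ⟨hw, R.mem_held.2 this⟩
    · exact Or.inr hw
  · rw [Set.ncard_coe_finset]
    rfl

end Propose

/-! ### Gossip of the tx_pools -/

section Gossip

variable (R : Round V P Pool Digest)

theorem subset_foldl_gossipStep (l : List (P × P × Pool)) (store : P → Set Pool) (q : P) :
    store q ⊆ l.foldl R.gossipStep store q := by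
  induction l generalizing store with
  | nil => exact subset_rfl
  | cons e l ih => exact Set.Subset.trans Set.subset_union_left (ih (R.gossipStep store e))

/-- Stores only grow, so `A` still has `m` whenever its transmission comes up. -/
theorem mem_foldl_gossipStep {l : List (P × P × Pool)} {store : P → Set Pool} {A B : P}
    {m : Pool} (hm : m ∈ store A) (hl : (A, B, m) ∈ l) : m ∈ l.foldl R.gossipStep store B := by
  induction l generalizing store with
  | nil => simp at hl
  | cons e l ih =>
    rcases List.mem_cons.1 hl with rfl | hl
    · exact R.subset_foldl_gossipStep l _ _ (Or.inr ⟨rfl, rfl, fun _ => hm⟩)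
    · exact ih (Or.inl hm) hl

theorem mem_availablePools {a : Adversary V P Pool Digest} {ω : R.Choices}
    (hg : R.GossipComplete a ω) {A : P} (hA : A ∈ R.honestPolitician) {m : Pool}
    (hm : m ∈ R.initialPools a ω A) {v : V} (hv : R.Good v) : m ∈ R.availablePools a ω v := by
  obtain ⟨-, p, hp, hph⟩ := hv
  refine Or.inr ⟨p, hp, Or.inl ⟨hph, ?_⟩⟩
  by_cases h : A = p
  · subst h
    exact R.subset_foldl_gossipStep _ _ _ hm
  · exact R.mem_foldl_gossipStep hm (hg A hA p hph h m hm)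

/-- The choices of `v` that do not bring the `i`-th tx_pool to an honest politician. -/
def missing (i : Fin rho) (v : V) : Set (R.Choice v) :=
  {c | ¬ (i ∈ c.1.1 ∧ c.1.2 ∈ R.honestPolitician)}

/-- The hypothesis ranges over all widely held indices, not just those proposed: the proposal may
depend on the adversary, `goodHolders` does not. -/
theorem hasAll_proposalOf [Fintype V] {a : Adversary V P Pool Digest} {ω : R.Choices}
    (hg : R.GossipComplete a ω) {u v : V} (hu : R.Good u) (hv : R.Good v)
    (h : ∀ i, maxBad + delta ≤ (R.goodHolders i).card + R.numBad →
      ∃ w ∈ R.goodHolders i, ω w ∉ R.missing i w) :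
    R.HasAll a ω v (R.proposalOf a u).2 := by
  intro i d hd
  have hp := R.picks_of_idList hd
  obtain ⟨w, hw, hup⟩ := h i (R.le_card_goodHolders a hu hp)
  simp only [missing, Set.mem_ofPred_eq, not_not] at hup
  rw [mem_goodHolders, mem_held] at hw
  obtain ⟨m, hm⟩ := Option.ne_none_iff_exists'.1 hw.2
  exact ⟨m, R.mem_availablePools hg hup.2 (Or.inl (Or.inl ⟨w, hw.1, rfl, i, hup.1, hm⟩)) hv,
    R.hash_eq_of_picks a hu hw.1 hp hm⟩

end Gossip

/-! ### Probability of a missing tx_pool -/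

section Probability

/-- A random `k`-subset of `h` elements contains a given one with probability `k / h`, here at least
1/9. -/
theorem choose_le_nine_mul {h k : ℕ} (hh : 0 < h) (hk : h ≤ 9 * k) (hk0 : 0 < k) :
    h.choose k ≤ 9 * (h - 1).choose (k - 1) := by
  obtain ⟨h, rfl⟩ := Nat.exists_eq_add_of_le' hh
  obtain ⟨k, rfl⟩ := Nat.exists_eq_add_of_le' hk0
  simp only [Nat.add_sub_cancel]
  have h₁ := Nat.add_one_mul_choose_eq h k
  have h₂ := Nat.mul_le_mul_left ((h + 1).choose (k + 1)) hk
  refine le_of_mul_le_mul_left (a := h + 1) ?_ hh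
  linarith

variable (R : Round V P Pool Digest)

theorem ncard_univ_choice (v : V) :
    (Set.univ : Set (R.Choice v)).ncard =
      ((R.held v).powersetCard (min reuploadSize (R.held v).card) : Set (Finset (Fin rho))).ncard *
        (Set.univ : Set P).ncard := by
  rw [← Set.ncard_prod, ← Set.ncard_image_of_injective (Set.univ : Set (R.Choice v))
    (f := fun c : R.Choice v => c.1) fun _ _ h => Subtype.ext h]
  congr 1
  ext c
  simp only [Set.mem_image, Set.mem_prod, Finset.mem_coe, Finset.mem_powersetCard, Set.mem_univ,
    and_true, true_and]
  exact ⟨fun ⟨x, hx⟩ => hx ▸ x.2, fun h => ⟨⟨c, h⟩, rfl⟩⟩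

theorem ncard_compl_missing (i : Fin rho) (v : V) :
    (R.missing i v)ᶜ.ncard =
      ((((R.held v).powersetCard (min reuploadSize (R.held v).card)).filter (i ∈ ·) :
        Finset (Finset (Fin rho))) : Set (Finset (Fin rho))).ncard * R.honestPolitician.ncard := by
  rw [← Set.ncard_prod, ← Set.ncard_image_of_injective (R.missing i v)ᶜ
    (f := fun c : R.Choice v => c.1) fun _ _ h => Subtype.ext h]
  congr 1
  ext c
  simp only [missing, Set.mem_image, Set.mem_compl_iff, Set.mem_ofPred_eq, not_not, Set.mem_prod,
    Finset.mem_coe, Finset.mem_filter, Finset.mem_powersetCard]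
  constructor
  · rintro ⟨x, hx, rfl⟩
    exact ⟨⟨x.2, hx.1⟩, hx.2⟩
  · rintro ⟨⟨h, hi⟩, hc⟩
    exact ⟨⟨c, h⟩, ⟨hi, hc⟩, rfl⟩

theorem card_filter_mem_powersetCard {α : Type*} [DecidableEq α] {s : Finset α} {i : α}
    (hi : i ∈ s) {k : ℕ} (hk : 0 < k) :
    ((s.powersetCard k).filter (i ∈ ·)).card = (s.card - 1).choose (k - 1) := by
  have h := Finset.card_filter_powersetCard_subset {i} s k (by simpa using hi)
    (by simpa using Nat.one_le_of_lt hk)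
  simpa using h

theorem card_choice_le [Fintype P]
    (hγ : Fintype.card P ≤ 5 * R.honestPolitician.ncard) {i : Fin rho} {v : V}
    (hi : i ∈ R.held v) :
    (Set.univ : Set (R.Choice v)).ncard ≤ 45 * (R.missing i v)ᶜ.ncard := by
  have h0 : 0 < (R.held v).card := Finset.card_pos.2 ⟨i, hi⟩
  have h45 : (R.held v).card ≤ 45 := (Finset.card_le_univ _).trans (Fintype.card_fin _).le
  -- The worst case is a member that holds all 45 tx_pools and uploads 5.
  have hk : (R.held v).card ≤ 9 * min reuploadSize (R.held v).card := by
    unfold reuploadSize; omega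
  have hk0 : 0 < min reuploadSize (R.held v).card := by
    unfold reuploadSize; omega
  rw [ncard_univ_choice, ncard_compl_missing, Set.ncard_coe_finset, Set.ncard_coe_finset,
    card_filter_mem_powersetCard hi hk0, Finset.card_powersetCard, Set.ncard_univ,
    Nat.card_eq_fintype_card]
  -- 45 = 9 · 5: the factor 9 is for the tx_pool, the factor 5 for hitting an honest politician.
  calc _ ≤ _ := Nat.mul_le_mul (choose_le_nine_mul h0 hk hk0) hγ
    _ = _ := by ring

theorem uniformOn_missing_le [Fintype P]
    (hγ : Fintype.card P ≤ 5 * R.honestPolitician.ncard) {i : Fin rho} {v : V}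
    (hi : i ∈ R.held v) :
    uniformOn (Set.univ : Set (R.Choice v)) (R.missing i v) ≤ ENNReal.ofReal (44 / 45) := by
  have := Fintype.ofFinite (R.Choice v)
  have h₁ := R.card_choice_le hγ hi
  have h₂ := Set.ncard_add_ncard_compl (R.missing i v)
  have h₃ : 0 < Fintype.card (R.Choice v) := Fintype.card_pos
  rw [Set.ncard_univ, Nat.card_eq_fintype_card] at h₁
  rw [Nat.card_eq_fintype_card] at h₂
  rw [uniformOn_univ, Measure.count_apply (by trivial),
    ← Set.Finite.cast_ncard_eq (Set.toFinite _)]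
  refine ENNReal.div_le_of_le_mul ?_
  rw [ENat.toENNReal_coe, ← ENNReal.ofReal_natCast, ← ENNReal.ofReal_natCast,
    ← ENNReal.ofReal_mul (by norm_num)]
  refine ENNReal.ofReal_le_ofReal ?_
  have h₄ : 45 * (R.missing i v).ncard ≤ 44 * Fintype.card (R.Choice v) := by omega
  have h₅ : (45 : ℝ) * (R.missing i v).ncard ≤ 44 * Fintype.card (R.Choice v) := by
    exact_mod_cast h₄
  linarith

theorem choiceLaw_missing_le [Fintype V] [Fintype P]
    (hγ : Fintype.card P ≤ 5 * R.honestPolitician.ncard) (i : Fin rho) :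
    R.choiceLaw {ω | ∀ w ∈ R.goodHolders i, ω w ∈ R.missing i w} ≤
      ENNReal.ofReal (44 / 45) ^ (R.goodHolders i).card := by
  have h := Measure.pi_pi_finset
    (μ := fun v => uniformOn (Set.univ : Set (R.Choice v))) (R.missing i) (R.goodHolders i)
  have hset : {ω : R.Choices | ∀ w ∈ R.goodHolders i, ω w ∈ R.missing i w} =
      Set.pi ↑(R.goodHolders i) (R.missing i) := by
    ext ω
    simp [Set.mem_pi]
  rw [choiceLaw, hset, h]
  exact Finset.prod_le_pow_card _ _ _ fun w hw =>
    R.uniformOn_missing_le hγ (R.mem_goodHolders.1 hw).2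

/-- With probability at least `1 - 0.017`, all tx_pools that many good members hold are uploaded to
an honest politician. -/
theorem choiceLaw_exists_missing_le [Fintype V] [Fintype P]
    (hn : Fintype.card V ≤ 2300) (hgap : 3 * R.numBad + 1 ≤ Fintype.card V)
    (hγ : Fintype.card P ≤ 5 * R.honestPolitician.ncard) :
    R.choiceLaw {ω | ∃ i, maxBad + delta ≤ (R.goodHolders i).card + R.numBad ∧
      ∀ w ∈ R.goodHolders i, ω w ∈ R.missing i w} ≤ ENNReal.ofReal 0.017 := by
  have hone : ∀ i, R.choiceLaw {ω | maxBad + delta ≤ (R.goodHolders i).card + R.numBad ∧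
      ∀ w ∈ R.goodHolders i, ω w ∈ R.missing i w} ≤ ENNReal.ofReal ((44 / 45) ^ 356) := by
    intro i
    by_cases hi : maxBad + delta ≤ (R.goodHolders i).card + R.numBad
    -- From `hgap` and `hn`, `numBad` is at most 766, and 772 + 350 - 766 = 356.
    · have hcard : 356 ≤ (R.goodHolders i).card := by
        unfold maxBad delta at hi
        omega
      rw [ENNReal.ofReal_pow (by norm_num)]
      refine (measure_mono fun ω hω => hω.2).trans ((R.choiceLaw_missing_le hγ i).trans ?_)
      exact pow_le_pow_right_of_le_one' (ENNReal.ofReal_le_one.2 (by norm_num)) hcard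
    · simp [hi]
  -- The left side is about 0.0151.
  have hnum : (45 : ℝ) * (44 / 45) ^ 356 ≤ 0.017 := by
    rw [show 356 = 89 * 4 from rfl, pow_mul]
    norm_num
  rw [show {ω : R.Choices | ∃ i, maxBad + delta ≤ (R.goodHolders i).card + R.numBad ∧
      ∀ w ∈ R.goodHolders i, ω w ∈ R.missing i w} =
      ⋃ i, {ω | maxBad + delta ≤ (R.goodHolders i).card + R.numBad ∧
        ∀ w ∈ R.goodHolders i, ω w ∈ R.missing i w} by ext; simp]
  refine (measure_iUnion_fintype_le _ _).trans ((Finset.sum_le_card_nsmul _ _ _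
    fun i _ => hone i).trans ?_)
  rw [Finset.card_univ, Fintype.card_fin, nsmul_eq_mul, ← ENNReal.ofReal_natCast,
    ← ENNReal.ofReal_mul (Nat.cast_nonneg _)]
  exact ENNReal.ofReal_le_ofReal hnum

end Probability

end Round

end Blockene

theorem mainTheorem6 {V P Pool Digest : Type*} [Fintype V] [Fintype P]
    (R : Blockene.Round V P Pool Digest)
    (hn : Fintype.card V ≤ 2300)
    (hgap : 3 * R.numBad + 1 ≤ Fintype.card V)
    (hγ : (({p : P | p ∉ R.honestPolitician}.ncard : ℕ) : ℝ) ≤ 0.8 * Fintype.card P)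
    (u : V) (hgood : R.Good u) (hwin : R.IsWinningProposer u)
    (adv : R.Choices → Blockene.Adversary V P Pool Digest)
    (hadv : ∀ ω, R.GossipComplete (adv ω) ω) :
    R.choiceLaw {ω | ¬ R.AllGoodAgreeOn (adv ω) ω (R.proposalOf (adv ω) u)} ≤
      ENNReal.ofReal 0.017 := by
  have hP : Fintype.card P ≤ 5 * R.honestPolitician.ncard := by
    have h := Set.ncard_add_ncard_compl R.honestPolitician
    rw [Nat.card_eq_fintype_card] at h
    have h' : (R.honestPolitician.ncard : ℝ) + (R.honestPoliticianᶜ.ncard : ℝ) =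
        Fintype.card P := by exact_mod_cast h
    have hc : {p : P | p ∉ R.honestPolitician} = R.honestPoliticianᶜ := rfl
    rw [hc] at hγ
    have : (Fintype.card P : ℝ) ≤ 5 * R.honestPolitician.ncard := by linarith
    exact_mod_cast this
  -- Monotonicity needs no measurability, so `adv` may depend on `ω` in any way.
  refine (measure_mono fun ω hω => ?_).trans (R.choiceLaw_exists_missing_le hn hgap hP)
  by_contra hno
  refine hω (R.allGoodAgreeOn_of_initialValue _ ω hgap fun v hv =>
    R.initialValue_eq _ ω hgood hwin hv (R.hasAll_proposalOf (hadv ω) hgood hv fun i hi => ?_))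
  by_contra! hall
  exact hno ⟨i, hi, hall⟩
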